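/- Let $W, W_1, W_2, \dots$ be independent identically distributed nonnegative random variables with $\mathbb{E}W<\infty$. For each $n\ge 1$ let $L_n = W_1+\cdots+W_n$, and let $E_n$ be the number of edges of the generalized random graph on the vertex set $\{1,\dots,n\}$ with vertex weights $W_1,\dots,W_n$; that is, of the random simple graph in which, conditionally on $W_1,\dots,W_n$, the edges between the pairs $1\le i<j\le n$ are present independently of each other, the edge $ij$ with probability $$p_{ij}=\frac{W_iW_j}{L_n+W_iW_j}$$ (read as $0$ if $L_n=0$). Let $(a_n)_{n\ge1}$ be nonzero real numbers, let $1<\alpha<2$, and let $F$ be a stable distribution with characteristic exponent $\alpha$; that is, $F$ is not concentrated at a single point and, if $X,X_1,X_2,\dots$ are independent with law $F$, then for every $n\ge 1$ there is $\gamma_n\in\mathbb{R}$ such that $X_1+\cdots+X_n$ has the same law as $n^{1/\alpha}X+\gamma_n$. If $$\frac{W_1+\cdots+W_n-n\,\mathbb{E}W}{a_n}\stackrel{d}{\longrightarrow}F,$$ then $$\frac{2E_n-n\,\mathbb{E}W}{a_n}\stackrel{d}{\longrightarrow}F.$$ -/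

import Mathlib

open MeasureTheory ProbabilityTheory Filter

/-- A probability law `F` on the real line is *stable with characteristic exponent `α`* if it is not
concentrated at one point and, for independent `X, X₁, X₂, …` with law `F` and every `n ≥ 1`,
the sum `X₁ + ⋯ + Xₙ` has the same law as `n ^ (1 / α) * X + γ` for some real constant `γ = γₙ`. -/
structure IsStableLaw (α : ℝ) (F : Measure ℝ) : Prop where
  isProbabilityMeasure : IsProbabilityMeasure F
  nondegenerate : ∀ x : ℝ, F ≠ Measure.dirac x
  stable : ∀ n : ℕ, 0 < n → ∃ γ : ℝ,
    (Measure.pi (fun _ : Fin n => F)).map (fun x => ∑ i, x i)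
      = F.map (fun x => (n : ℝ) ^ (1 / α) * x + γ)

/-- The edge probability `wᵢ wⱼ / (ℓ + wᵢ wⱼ)`, where `ℓ = ∑ₖ wₖ` is the total weight.
If all weights vanish this is `0 / 0 = 0`: there are no edges. -/
noncomputable def edgeProb {n : ℕ} (w : Fin n → ℝ) (i j : Fin n) : ℝ :=
  w i * w j / ((∑ k, w k) + w i * w j)

/-- The random simple graph `G` on `n` vertices is a *generalized random graph* with (random) vertex
weights `W`: conditionally on the weights, the edges between different pairs `i < j` are present
independently of each other, the edge `ij` with probability `edgeProb W i j`. -/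
structure IsGeneralizedRandomGraph {Ω : Type*} [MeasurableSpace Ω] (P : Measure Ω) {n : ℕ}
    (W : Fin n → Ω → ℝ) (G : Ω → SimpleGraph (Fin n)) : Prop where
  measurableSet_adj : ∀ i j : Fin n, MeasurableSet {ω | (G ω).Adj i j}
  condProb_adj : ∀ i j : Fin n, i < j →
    P⟦{ω | (G ω).Adj i j} | MeasurableSpace.comap (fun ω k => W k ω) inferInstance⟧
      =ᵐ[P] fun ω => edgeProb (fun k => W k ω) i j
  condIndep : ∀ S : Finset (Fin n × Fin n), (∀ e ∈ S, e.1 < e.2) →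
    P⟦⋂ e ∈ S, {ω | (G ω).Adj e.1 e.2} | MeasurableSpace.comap (fun ω k => W k ω) inferInstance⟧
      =ᵐ[P] ∏ e ∈ S,
        P⟦{ω | (G ω).Adj e.1 e.2} | MeasurableSpace.comap (fun ω k => W k ω) inferInstance⟧

/-! Write L for the total weight and Q for the sum of `edgeProb` over ordered pairs i ≠ j, and split
2E - n𝔼W = (2E - Q) + (Q - L) + (L - n𝔼W). The last term has the assumed stable limit, so it
suffices that the other two are o(a_n) in probability.

Given the weights, 2E has mean Q, and 𝔼(2E - Q)² ≤ 2n𝔼W (`IsGeneralizedRandomGraph.integral_sq_le`).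
Chebyshev finishes once |a_n| ≥ K n^s with s > 1/2. Since L = ∑ w_i w_j / L over all i, j, the gap L
- Q consists of the terms x - x/(1+x) with x = w_i w_j / L, plus the diagonal.
`abs_sum_edgeProb_offDiag_sub_le` bounds it through ∑ w_k^β, and the strong law makes it O(n^(2-β))
+ O(n^(1-β/2)) almost surely. This is o(a_n) if 𝔼W^β < ∞ and 2 - β < s. Suitable s < 1/α and β < α
exist because 2 - α < 1/α.

The growth of a_n and the moment of W come from the stable limit (`exists_growth_and_moments`). The
modulus of the limiting characteristic function is exp(-c|t|^α), and |φ_W(t/a_n)|^n tends to it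
continuously in t. This forces |a_(n/2)| / |a_n| → 2^(-1/α), hence polynomial bounds with exponents
arbitrarily close to 1/α. It also gives 1 - |φ_W(t/a_n)|² = O(1/n) on compact sets, which bounds the
tails of the symmetrized law and so gives moments. -/

open scoped Topology

/-! ### Characteristic functions of stable laws -/

/-- The convolution of a law with its reflection has the squared modulus as characteristic
function. -/
lemma charFun_conv_map_neg (ν : Measure ℝ) [IsProbabilityMeasure ν] (t : ℝ) :
    charFun (ν ∗ ν.map (fun x => -x)) t = ((‖charFun ν t‖ ^ 2 : ℝ) : ℂ) := by
  have : IsProbabilityMeasure (ν.map (fun x => -x)) :=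
    Measure.isProbabilityMeasure_map (by fun_prop)
  have h : charFun (ν.map (fun x => -x)) t = charFun ν (-t) := by
    have := charFun_map_mul (μ := ν) (-1) t
    simpa using this
  rw [charFun_conv, h, charFun_neg, Complex.mul_conj, Complex.normSq_eq_norm_sq]

lemma norm_charFun_abs (ν : Measure ℝ) (t : ℝ) : ‖charFun ν |t|‖ = ‖charFun ν t‖ := by
  rcases abs_choice t with h | h <;> rw [h]
  rw [charFun_neg, RCLike.norm_conj]

/-- A law whose characteristic function has modulus one everywhere is a point mass. -/
lemma exists_eq_dirac_of_norm_charFun_eq_one (ν : Measure ℝ) [IsProbabilityMeasure ν]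
    (h : ∀ t, ‖charFun ν t‖ = 1) : ∃ x, ν = Measure.dirac x := by
  have : IsProbabilityMeasure (ν.map (fun x => -x)) :=
    Measure.isProbabilityMeasure_map (by fun_prop)
  have h1 : ν ∗ ν.map (fun x => -x) = Measure.dirac 0 := by
    refine Measure.ext_of_charFun ?_
    ext t
    rw [charFun_conv_map_neg, h, charFun_dirac]
    simp
  have h2 : ∀ᵐ z ∂(ν ∗ ν.map (fun x => -x)), z = 0 := by
    rw [h1, ae_dirac_eq]
    simp
  -- By Fubini, some fixed `x` equals ν-almost every `y`, as the difference of independent copies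
  -- vanishes.
  have h3 := Measure.ae_ae_of_ae_prod (ae_of_ae_map (by fun_prop) h2)
  obtain ⟨x, hx⟩ := h3.exists
  replace hx := ae_of_ae_map (by fun_prop) hx
  refine ⟨x, ?_⟩
  have h4 : (fun y : ℝ => y) =ᵐ[ν] fun _ => x := by
    filter_upwards [hx] with y hy
    linarith
  calc ν = ν.map (fun y : ℝ => y) := Measure.map_id'.symm
    _ = ν.map (fun _ => x) := Measure.map_congr h4
    _ = Measure.dirac x := by simp

/-- Taking moduli removes the unknown centering `γ`, which contributes only a factor exp(iγt). -/
lemma IsStableLaw.norm_charFun_pow {α : ℝ} {F : Measure ℝ} (hF : IsStableLaw α F)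
    {n : ℕ} (hn : 0 < n) (t : ℝ) :
    ‖charFun F t‖ ^ n = ‖charFun F ((n : ℝ) ^ (1 / α) * t)‖ := by
  have := hF.isProbabilityMeasure
  obtain ⟨γ, hγ⟩ := hF.stable n hn
  have h1 := congrArg (fun m => ‖charFun m t‖) hγ
  have h2 : F.map (fun x => (n : ℝ) ^ (1 / α) * x + γ)
      = (F.map (fun x => (n : ℝ) ^ (1 / α) * x)).map (fun x => x + γ) := by
    rw [Measure.map_map (by fun_prop) (by fun_prop)]
    rfl
  have h3 := congrFun (charFun_map_sum_pi_eq_prod (fun _ : Fin n => F)) t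
  have h4 : ‖charFun (F.map (fun x => (n : ℝ) ^ (1 / α) * x + γ)) t‖
      = ‖charFun F ((n : ℝ) ^ (1 / α) * t)‖ := by
    rw [h2, charFun_map_add_const, charFun_map_mul, norm_mul]
    simp [Complex.norm_exp]
  rw [← h4, ← h1]
  erw [h3]
  simp

/-- The modulus of the characteristic function of a stable law. -/
lemma IsStableLaw.norm_charFun {α : ℝ} (hα : 0 < α) {F : Measure ℝ} (hF : IsStableLaw α F) :
    ∃ c : ℝ, 0 < c ∧ ∀ t, ‖charFun F t‖ = Real.exp (-(c * |t| ^ α)) := by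
  have := hF.isProbabilityMeasure
  have hcont : Continuous fun t => ‖charFun F t‖ := by
    exact (continuous_charFun (μ := F)).norm
  have hα0 : α ≠ 0 := hα.ne'
  -- Near 0 the modulus is positive by continuity; the value at `t` is the n-th power of the value
  -- at n^(-1/α) t.
  have hpos : ∀ t, 0 < ‖charFun F t‖ := by
    intro t
    have h1 : Tendsto (fun n : ℕ => ‖charFun F (((n : ℝ) ^ (1 / α))⁻¹ * t)‖) atTop (𝓝 1) := by
      have h2 : Tendsto (fun n : ℕ => ((n : ℝ) ^ (1 / α))⁻¹ * t) atTop (𝓝 (0 * t)) := by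
        refine Tendsto.mul_const _ ?_
        exact tendsto_inv_atTop_zero.comp
          ((tendsto_rpow_atTop (by positivity)).comp tendsto_natCast_atTop_atTop)
      have h3 := (hcont.tendsto (0 * t)).comp h2
      simpa [Function.comp_def] using h3
    obtain ⟨n, hn, hn0⟩ := ((h1.eventually_const_lt zero_lt_one).and (eventually_gt_atTop 0)).exists
    have h4 := hF.norm_charFun_pow hn0 (((n : ℝ) ^ (1 / α))⁻¹ * t)
    have hn' : (0 : ℝ) < n := by exact_mod_cast hn0
    rw [← mul_assoc, mul_inv_cancel₀ (by positivity), one_mul] at h4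
    rw [← h4]
    positivity
  set M : ℝ → ℝ := fun t => -Real.log ‖charFun F t‖ with hM
  have hMcont : Continuous M := (hcont.log fun t => (hpos t).ne').neg
  have hMmul : ∀ (n : ℕ), 0 < n → ∀ t, M ((n : ℝ) ^ (1 / α) * t) = n * M t := by
    intro n hn t
    simp only [hM]
    rw [← hF.norm_charFun_pow hn, Real.log_pow]
    ring
  have hM0 : M 0 = 0 := by simp [hM]
  have hrat : ∀ q : ℚ, M (|(q : ℝ)| ^ (1 / α)) = |(q : ℝ)| * M 1 := by
    intro q
    rcases eq_or_ne q 0 with rfl | hq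
    · simp [hM0, Real.zero_rpow (inv_ne_zero hα0)]
    have hn : 0 < q.num.natAbs := Int.natAbs_pos.mpr (Rat.num_ne_zero.mpr hq)
    have h1 := hMmul q.num.natAbs hn 1
    have h2 := hMmul q.den q.den_pos (|(q : ℝ)| ^ (1 / α))
    have hd : (0 : ℝ) < q.den := by exact_mod_cast q.den_pos
    have h3 : (q.den : ℝ) * |(q : ℝ)| = (q.num.natAbs : ℝ) := by
      have : (q.den : ℝ) * (q : ℝ) = q.num := by
        exact_mod_cast Rat.den_mul_eq_num q
      rw [Nat.cast_natAbs, Int.cast_abs, ← this, abs_mul, abs_of_pos hd]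
    rw [← Real.mul_rpow hd.le (abs_nonneg _), h3] at h2
    rw [mul_one] at h1
    rw [h1, ← h3, mul_assoc] at h2
    exact (mul_left_cancel₀ hd.ne' h2).symm
  -- Homogeneity extends from ℚ by density; the absolute values make both sides continuous on all of
  -- ℝ.
  have hreal : ∀ r : ℝ, M (|r| ^ (1 / α)) = |r| * M 1 := by
    intro r
    refine congrFun (DenseRange.equalizer (Rat.denseRange_cast (𝕜 := ℝ))
      (g := fun r : ℝ => M (|r| ^ (1 / α))) (h := fun r => |r| * M 1) ?_ ?_ ?_) r
    · refine hMcont.comp ?_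
      exact continuous_abs.rpow_const fun x => Or.inr (by positivity)
    · fun_prop
    · ext q
      exact hrat q
  have hMt : ∀ t, M t = M 1 * |t| ^ α := by
    intro t
    have h1 := hreal (|t| ^ α)
    rw [abs_of_nonneg (by positivity), ← Real.rpow_mul (abs_nonneg _), mul_one_div_cancel hα0,
      Real.rpow_one] at h1
    rw [mul_comm, ← h1]
    simp only [hM, norm_charFun_abs]
  have hexp : ∀ t, ‖charFun F t‖ = Real.exp (-(M 1 * |t| ^ α)) := by
    intro t
    rw [← hMt, hM]
    simp [Real.exp_log (hpos t)]
  refine ⟨M 1, ?_, hexp⟩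
  have hM1 : 0 ≤ M 1 := by
    have := Real.log_nonpos (norm_nonneg _) (norm_charFun_le_one (μ := F) 1)
    simp only [hM]
    linarith
  refine hM1.lt_of_ne fun h => ?_
  obtain ⟨x, hx⟩ := exists_eq_dirac_of_norm_charFun_eq_one F (fun t => by rw [hexp, ← h]; simp)
  exact hF.nondegenerate x hx

/-! ### Convergence in distribution in terms of characteristic functions -/

/-- The characteristic functions of a sequence converging in distribution converge continuously. -/
lemma MeasureTheory.TendstoInDistribution.tendsto_charFun_prod {Ω : Type*} [MeasurableSpace Ω]
    {P : Measure Ω} [IsProbabilityMeasure P] {X : ℕ → Ω → ℝ} {F : Measure ℝ}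
    [IsProbabilityMeasure F]
    (h : TendstoInDistribution X atTop (id : ℝ → ℝ) (fun _ => P) F) (t : ℝ) :
    Tendsto (fun p : ℕ × ℝ => charFun (P.map (X p.1)) p.2) (atTop ×ˢ 𝓝 t)
      (𝓝 (charFun F t)) := by
  -- Slutsky along pairs (n, u): the constant variable u tends to t, so u X_n converges in law to
  -- tX. Evaluating characteristic functions at 1 gives the claim.
  have h1 : TendstoInDistribution (fun p : ℕ × ℝ => X p.1) (atTop ×ˢ 𝓝 t) (id : ℝ → ℝ)
      (fun _ => P) F :=
    ⟨fun p => h.forall_aemeasurable p.1, h.aemeasurable_limit, h.tendsto.comp tendsto_fst⟩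
  have h2 : TendstoInMeasure P (fun (p : ℕ × ℝ) (_ : Ω) => p.2) (atTop ×ˢ 𝓝 t) (fun _ => t) := by
    intro ε hε
    refine tendsto_const_nhds.congr' ?_
    have h0 : Tendsto (fun p : ℕ × ℝ => edist p.2 t) (atTop ×ˢ 𝓝 t) (𝓝 0) :=
      tendsto_iff_edist_tendsto_0.1 tendsto_snd
    filter_upwards [h0.eventually_lt_const hε] with p hp
    simp [not_le.2 hp]
  have h3 := h1.continuous_comp_prodMk_of_tendstoInMeasure_const
    (g := fun z : ℝ × ℝ => z.2 * z.1) (by fun_prop) h2 (fun p => by fun_prop)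
  have h4 := (ProbabilityMeasure.tendsto_iff_forall_integral_rclike_tendsto ℂ).1 h3.tendsto
    (BoundedContinuousFunction.innerProbChar (1 : ℝ))
  have h5 : ∀ (μ : Measure ℝ), ∫ x, BoundedContinuousFunction.innerProbChar (1 : ℝ) x ∂μ = charFun μ 1 :=
    fun μ => (charFun_eq_integral_innerProbChar).symm
  simp only [ProbabilityMeasure.coe_mk, h5] at h4
  have h6 : charFun (F.map fun ω => t * id ω) 1 = charFun F t := by
    have := charFun_map_mul (μ := F) t 1
    simpa using this
  rw [h6] at h4
  refine h4.congr fun p => ?_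
  have h7 : P.map (fun ω => p.2 * X p.1 ω) = (P.map (X p.1)).map (fun x => p.2 * x) := by
    rw [AEMeasurable.map_map_of_aemeasurable (by fun_prop) (h.forall_aemeasurable p.1)]
    rfl
  rw [h7, charFun_map_mul, mul_one]

/-- The modulus of the characteristic function of a normalized sum of i.i.d. variables. -/
lemma norm_charFun_map_sum {Ω : Type*} [MeasurableSpace Ω] {P : Measure Ω}
    [IsProbabilityMeasure P] {W : ℕ → Ω → ℝ} (hW_meas : ∀ i, Measurable (W i))
    (hW_indep : iIndepFun W P) (hW_ident : ∀ i, IdentDistrib (W i) (W 0) P P)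
    (n : ℕ) (d b t : ℝ) :
    ‖charFun (P.map fun ω => ((∑ i ∈ Finset.range n, W i ω) - d) / b) t‖
      = ‖charFun (P.map (W 0)) (t / b)‖ ^ n := by
  have h1 : P.map (fun ω => ((∑ i ∈ Finset.range n, W i ω) - d) / b)
      = ((P.map fun ω => ∑ i ∈ Finset.range n, W i ω).map (fun x => b⁻¹ * x)).map
        (fun x => x + -(d / b)) := by
    rw [Measure.map_map (by fun_prop) (by fun_prop), Measure.map_map (by fun_prop) (by fun_prop)]
    congr 1
    ext ω
    simp only [Function.comp]
    ring
  have h2 := congrFun ((hW_indep.restrict (Finset.range n)).charFun_map_fun_finsetSum_eq_prod (s := Finset.range n)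
    (fun i _ => (hW_meas i).aemeasurable)) (b⁻¹ * t)
  rw [h1, charFun_map_add_const, charFun_map_mul, norm_mul, h2]
  simp only [Finset.prod_apply, norm_prod]
  have h3 : ∀ i, P.map (W i) = P.map (W 0) := fun i => (hW_ident i).map_eq
  simp [h3, Complex.norm_exp, div_eq_inv_mul]

/-! ### Growth of the norming constants -/

/-- Growth along halving: if `b (n / 2) / b n` tends to `2 ^ (-t)`, then `b n` eventually dominates
a multiple of `n ^ s`, for every `s < t`. -/
lemma exists_mul_rpow_le_of_tendsto_div {b : ℕ → ℝ} (hb : ∀ᶠ n in atTop, 0 < b n) {t s : ℝ}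
    (hst : s < t) (h : Tendsto (fun n => b (n / 2) / b n) atTop (𝓝 (2 ^ (-t)))) :
    ∃ K : ℝ, 0 < K ∧ ∀ᶠ n : ℕ in atTop, K * (n : ℝ) ^ s ≤ b n := by
  set ρ : ℝ := 2 ^ s with hρ
  have hρ0 : 0 < ρ := by positivity
  have h1 : (2 : ℝ) ^ (-t) < ρ⁻¹ := by
    rw [hρ, ← Real.rpow_neg (by norm_num)]
    exact Real.rpow_lt_rpow_of_exponent_lt (by norm_num) (by linarith)
  obtain ⟨N₀, hN₀⟩ := eventually_atTop.1 (hb.and (h.eventually_lt_const h1))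
  set N := max N₀ 1 with hN
  have hN1 : 1 ≤ N := le_max_right _ _
  have hpos : ∀ n, N ≤ n → 0 < b n := fun n hn => (hN₀ n ((le_max_left _ _).trans hn)).1
  have hstep : ∀ n, N ≤ n → ρ * b (n / 2) ≤ b n := by
    intro n hn
    have h2 := (hN₀ n ((le_max_left _ _).trans hn)).2
    rw [div_lt_iff₀ (hpos n hn)] at h2
    calc ρ * b (n / 2) ≤ ρ * (ρ⁻¹ * b n) := by gcongr
      _ = b n := by field_simp
  -- Repeated halving brings every n ≥ N into [N, 2N), so the minimum over this block is a constant
  -- valid for all n ≥ N.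
  obtain ⟨m, hm, hmin⟩ := (Finset.Ico N (2 * N)).exists_min_image
    (fun n => b n / ρ ^ Nat.log 2 n) ⟨N, by simp; omega⟩
  have hm' := (Finset.mem_Ico.1 hm).1
  set K := b m / ρ ^ Nat.log 2 m with hK
  have hK0 : 0 < K := div_pos (hpos m hm') (by positivity)
  have hlog : ∀ n, N ≤ n → K * ρ ^ Nat.log 2 n ≤ b n := by
    intro n
    induction n using Nat.strong_induction_on with
    | _ n ih =>
      intro hn
      by_cases h2 : n < 2 * N
      · have := hmin n (Finset.mem_Ico.2 ⟨hn, h2⟩)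
        rwa [le_div_iff₀ (by positivity)] at this
      · have h3 := ih (n / 2) (by omega) (by omega)
        rw [Nat.log_of_one_lt_of_le (by norm_num) (by omega), pow_succ]
        calc K * (ρ ^ Nat.log 2 (n / 2) * ρ) = ρ * (K * ρ ^ Nat.log 2 (n / 2)) := by ring
          _ ≤ ρ * b (n / 2) := by gcongr
          _ ≤ b n := hstep n hn
  -- The factor 2^(-|s|) absorbs the gap between n and 2^(log₂ n) for either sign of `s`; negative
  -- `s` serves upper bounds via reciprocals.
  refine ⟨K * 2 ^ (-|s|), by positivity, eventually_atTop.2 ⟨N, fun n hn => ?_⟩⟩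
  refine le_trans ?_ (hlog n hn)
  have hn0 : (0 : ℝ) < n := by exact_mod_cast (by omega : 0 < n)
  have h4 : ρ ^ Nat.log 2 n = ((2 : ℝ) ^ Nat.log 2 n) ^ s := by
    rw [hρ, ← Real.rpow_natCast, ← Real.rpow_natCast, ← Real.rpow_mul (by norm_num),
      ← Real.rpow_mul (by norm_num), mul_comm]
  have h5 : (2 : ℝ) ^ Nat.log 2 n ≤ n := by
    exact_mod_cast Nat.pow_log_le_self 2 (by omega)
  have h6 : (n : ℝ) ≤ 2 * 2 ^ Nat.log 2 n := by
    have := (Nat.lt_pow_succ_log_self (b := 2) (by norm_num) n).le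
    rw [pow_succ, mul_comm] at this
    exact_mod_cast this
  rw [h4, mul_assoc]
  refine mul_le_mul_of_nonneg_left ?_ hK0.le
  rcases le_total 0 s with hs | hs
  · rw [abs_of_nonneg hs, Real.rpow_neg (by norm_num), inv_mul_le_iff₀ (by positivity),
      ← Real.mul_rpow (by norm_num) (by positivity)]
    exact Real.rpow_le_rpow hn0.le h6 hs
  · have h7 : (2 : ℝ) ^ (-|s|) ≤ 1 :=
      Real.rpow_le_one_of_one_le_of_nonpos (by norm_num) (by simp)
    calc (2 : ℝ) ^ (-|s|) * (n : ℝ) ^ s ≤ 1 * (n : ℝ) ^ s := by gcongr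
      _ = (n : ℝ) ^ s := one_mul _
      _ ≤ _ := Real.rpow_le_rpow_of_nonpos (by positivity) h5 hs

lemma tendsto_natCast_half_div_self :
    Tendsto (fun n : ℕ => ((n / 2 : ℕ) : ℝ) / n) atTop (𝓝 (1 / 2)) := by
  have h1 : Tendsto (fun n : ℕ => 1 / 2 - 1 / (n : ℝ)) atTop (𝓝 (1 / 2)) := by
    simpa using tendsto_const_nhds.sub (tendsto_one_div_atTop_nhds_zero_nat (𝕜 := ℝ))
  refine tendsto_of_tendsto_of_tendsto_of_le_of_le' h1 tendsto_const_nhds ?_ ?_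
  · filter_upwards [eventually_gt_atTop 0] with n hn
    have hn' : (0 : ℝ) < n := by exact_mod_cast hn
    have h2 : (n : ℝ) ≤ 2 * ((n / 2 : ℕ) : ℝ) + 1 := by
      exact_mod_cast (by omega : n ≤ 2 * (n / 2) + 1)
    rw [div_sub_div _ _ (by norm_num) hn'.ne', div_le_div_iff₀ (by positivity) hn']
    nlinarith
  · filter_upwards [eventually_gt_atTop 0] with n hn
    have hn' : (0 : ℝ) < n := by exact_mod_cast hn
    have h2 : 2 * ((n / 2 : ℕ) : ℝ) ≤ n := by
      exact_mod_cast (by omega : 2 * (n / 2) ≤ n)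
    rw [div_le_div_iff₀ hn' (by norm_num)]
    linarith

section

variable {f : ℝ → ℝ} {b : ℕ → ℝ} {c α : ℝ}

/-- If `b n = 0`, division by zero gives f(0)^n = 1, whereas the limit at t = 1 is exp(-c) < 1. -/
lemma eventually_ne_zero_of_tendsto_pow (hf0 : f 0 = 1) (hc : 0 < c)
    (h : ∀ t : ℝ, Tendsto (fun p : ℕ × ℝ => f (p.2 / b p.1) ^ p.1) (atTop ×ˢ 𝓝 t)
      (𝓝 (Real.exp (-(c * |t| ^ α))))) :
    ∀ᶠ n in atTop, b n ≠ 0 := by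
  have h1 : Tendsto (fun n : ℕ => f (1 / b n) ^ n) atTop (𝓝 (Real.exp (-(c * |1| ^ α)))) :=
    (h 1).comp (tendsto_id.prodMk tendsto_const_nhds)
  have h2 : Real.exp (-(c * |1| ^ α)) < 1 := by simpa using hc
  filter_upwards [h1.eventually_lt_const h2] with n hn hb
  simp [hb, hf0] at hn

lemma tendsto_mul_log_of_tendsto_pow
    (h : ∀ t : ℝ, Tendsto (fun p : ℕ × ℝ => f (p.2 / b p.1) ^ p.1) (atTop ×ˢ 𝓝 t)
      (𝓝 (Real.exp (-(c * |t| ^ α))))) (t : ℝ) :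
    Tendsto (fun p : ℕ × ℝ => p.1 * Real.log (f (p.2 / b p.1))) (atTop ×ˢ 𝓝 t)
      (𝓝 (-(c * |t| ^ α))) := by
  have h1 := (h t).log (Real.exp_pos _).ne'
  simpa only [Real.log_pow, Real.log_exp] using h1

/-- If `f (t / b n) ^ n` converges to `exp (-c |t| ^ α)`, continuously in `t`, then the norming
constants `b` are regularly varying along halving. -/
lemma tendsto_div_half_of_tendsto_pow (hf0 : f 0 = 1) (hb : ∀ n, 0 ≤ b n) (hc : 0 < c)
    (hα : 0 < α)
    (h : ∀ t : ℝ, Tendsto (fun p : ℕ × ℝ => f (p.2 / b p.1) ^ p.1) (atTop ×ˢ 𝓝 t)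
      (𝓝 (Real.exp (-(c * |t| ^ α))))) :
    Tendsto (fun n => b (n / 2) / b n) atTop (𝓝 (2 ^ (-(1 / α)))) := by
  have hlog := tendsto_mul_log_of_tendsto_pow h
  have hne := eventually_ne_zero_of_tendsto_pow hf0 hc h
  have hhalf : Tendsto (fun n : ℕ => n / 2) atTop atTop :=
    Nat.tendsto_div_const_atTop (by norm_num)
  have hne2 : ∀ᶠ n in atTop, b (n / 2) ≠ 0 := hhalf.eventually hne
  set u : ℕ → ℝ := fun n => b (n / 2) / b n with hu
  have hu0 : ∀ n, 0 ≤ u n := fun n => div_nonneg (hb _) (hb _)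
  -- Along an ultrafilter the ratio has a limit in the compact space [0, ∞], and it remains only to
  -- identify it.
  rw [tendsto_iff_ultrafilter]
  intro 𝒰 h𝒰
  have hratio : Tendsto (fun n : ℕ => ((n / 2 : ℕ) : ℝ) / n) 𝒰 (𝓝 (1 / 2)) :=
    tendsto_natCast_half_div_self.mono_left h𝒰
  have hn1 : Tendsto (fun n : ℕ => n * Real.log (f (1 / b n))) 𝒰 (𝓝 (-c)) := by
    have := (hlog 1).comp ((tendsto_id.prodMk tendsto_const_nhds : Tendsto (fun n : ℕ => (n, (1:ℝ)))
      atTop (atTop ×ˢ 𝓝 1)))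
    simpa [Function.comp_def] using this.mono_left h𝒰
  have hk1 : Tendsto (fun n : ℕ => ((n / 2 : ℕ) : ℝ) * Real.log (f (1 / b (n / 2)))) 𝒰 (𝓝 (-c)) := by
    have := (hlog 1).comp ((hhalf.prodMk tendsto_const_nhds : Tendsto (fun n : ℕ => (n / 2, (1:ℝ)))
      atTop (atTop ×ˢ 𝓝 1)))
    simpa [Function.comp_def] using this.mono_left h𝒰
  obtain ⟨x, -, hx⟩ := isCompact_univ.ultrafilter_le_nhds
    (𝒰.map fun n => ENNReal.ofReal (u n)) (by simp)
  rw [Ultrafilter.coe_map] at hx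
  change Tendsto (fun n => ENNReal.ofReal (u n)) 𝒰 (𝓝 x) at hx
  rcases eq_or_ne x ⊤ with rfl | hxt
  -- With an infinite ratio, 1 / b(n/2) = (1/u_n) / b(n) with 1/u_n → 0, so the limit at t = 0 gives
  -- 0 where the index n/2 gives a nonzero value.
  · exfalso
    have hu_top : Tendsto u 𝒰 atTop := ENNReal.tendsto_ofReal_nhds_top.1 hx
    have h1 := (hlog 0).comp ((tendsto_id.mono_left h𝒰 : Tendsto (fun n : ℕ => n) 𝒰 atTop).prodMk
      (tendsto_inv_atTop_zero.comp hu_top))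
    have h2 : Tendsto (fun n : ℕ => n * Real.log (f (1 / b (n / 2)))) 𝒰 (𝓝 0) := by
      rw [abs_zero, Real.zero_rpow hα.ne', mul_zero, neg_zero] at h1
      refine h1.congr' ?_
      filter_upwards [h𝒰 hne, h𝒰 hne2] with n hn hn2
      simp only [Function.comp, id, hu]
      congr 3
      field_simp
    have h3 := hratio.mul h2
    have h4 := tendsto_nhds_unique h3 (hk1.congr' ?_)
    · simp at h4
      exact hc.ne' h4
    · filter_upwards [h𝒰 (eventually_gt_atTop 0)] with n hn
      have : (n : ℝ) ≠ 0 := by exact_mod_cast (ne_of_gt hn)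
      field_simp
  · have hur : Tendsto u 𝒰 (𝓝 x.toReal) := by
      have := (ENNReal.tendsto_toReal hxt).comp hx
      refine this.congr fun n => ?_
      simp [ENNReal.toReal_ofReal (hu0 n)]
    set r := x.toReal with hr
    have hr0 : 0 ≤ r := ENNReal.toReal_nonneg
    -- Since 1 / b(n) = u_n / b(n/2), computing the limit of (n/2) log f(1 / b(n)) in two ways
    -- yields c r^α = c/2.
    have h1 := (hlog r).comp ((hhalf.mono_left h𝒰).prodMk hur)
    have h2 : Tendsto (fun n : ℕ => ((n / 2 : ℕ) : ℝ) * Real.log (f (1 / b n))) 𝒰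
        (𝓝 (-(c * r ^ α))) := by
      rw [abs_of_nonneg hr0] at h1
      refine h1.congr' ?_
      filter_upwards [h𝒰 hne, h𝒰 hne2] with n hn hn2
      simp only [Function.comp, hu]
      congr 3
      field_simp
    have h3 := hratio.mul hn1
    have h4 := tendsto_nhds_unique h3 (h2.congr' ?_)
    · have h5 : r ^ α = 1 / 2 := by
        have : c * (r ^ α) = c * (1 / 2) := by linarith
        exact mul_left_cancel₀ hc.ne' this
      have h6 : r = 2 ^ (-(1 / α)) := by
        rw [← Real.rpow_rpow_inv hr0 hα.ne', h5, Real.rpow_neg (by norm_num), one_div, one_div,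
          Real.inv_rpow (by norm_num)]
      rw [← h6]
      exact hur
    · filter_upwards [h𝒰 (eventually_gt_atTop 0)] with n hn
      have : (n : ℝ) ≠ 0 := by exact_mod_cast (ne_of_gt hn)
      field_simp

lemma exists_mul_rpow_le_of_tendsto_pow (hf0 : f 0 = 1) (hb : ∀ n, 0 ≤ b n) (hc : 0 < c)
    (hα : 0 < α)
    (h : ∀ t : ℝ, Tendsto (fun p : ℕ × ℝ => f (p.2 / b p.1) ^ p.1) (atTop ×ˢ 𝓝 t)
      (𝓝 (Real.exp (-(c * |t| ^ α))))) {s : ℝ} (hs : s < 1 / α) :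
    ∃ K : ℝ, 0 < K ∧ ∀ᶠ n : ℕ in atTop, K * (n : ℝ) ^ s ≤ b n := by
  refine exists_mul_rpow_le_of_tendsto_div ?_ hs (tendsto_div_half_of_tendsto_pow hf0 hb hc hα h)
  filter_upwards [eventually_ne_zero_of_tendsto_pow hf0 hc h] with n hn
  exact (hb n).lt_of_ne' hn

/-- This is the lower bound applied to 1/b, whose halving ratio tends to 2^(1/α), with negated
exponents. -/
lemma exists_le_mul_rpow_of_tendsto_pow (hf0 : f 0 = 1) (hb : ∀ n, 0 ≤ b n) (hc : 0 < c)
    (hα : 0 < α)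
    (h : ∀ t : ℝ, Tendsto (fun p : ℕ × ℝ => f (p.2 / b p.1) ^ p.1) (atTop ×ˢ 𝓝 t)
      (𝓝 (Real.exp (-(c * |t| ^ α))))) {s : ℝ} (hs : 1 / α < s) :
    ∃ K : ℝ, 0 < K ∧ ∀ᶠ n : ℕ in atTop, b n ≤ K * (n : ℝ) ^ s := by
  have hpos : ∀ᶠ n in atTop, 0 < b n := by
    filter_upwards [eventually_ne_zero_of_tendsto_pow hf0 hc h] with n hn
    exact (hb n).lt_of_ne' hn
  have h1 := (tendsto_div_half_of_tendsto_pow hf0 hb hc hα h).inv₀ (by positivity)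
  rw [← Real.rpow_neg (by norm_num)] at h1
  obtain ⟨K, hK, hK'⟩ := exists_mul_rpow_le_of_tendsto_div (b := fun n => (b n)⁻¹) (t := -(1 / α))
    (s := -s) (hpos.mono fun n hn => inv_pos.2 hn) (by linarith) (h1.congr fun n => by
      rw [inv_div, div_eq_mul_inv, inv_div_inv, div_eq_mul_inv])
  refine ⟨K⁻¹, inv_pos.2 hK, ?_⟩
  filter_upwards [hpos, hK', eventually_gt_atTop 0] with n hn hn2 hn0
  have hn0' : (0 : ℝ) < n := by exact_mod_cast hn0
  rw [Real.rpow_neg hn0'.le, le_inv_comm₀ (by positivity) hn] at hn2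
  simpa [mul_inv, mul_comm] using hn2

/-- The limit is bounded below by some ε > 0 on the compact set, and continuous convergence makes
f(t/b_n)^n > ε uniformly there. Then y = f(t/b_n) satisfies 1 - y² ≤ -2 log y ≤ 2|log ε|/n. -/
lemma exists_one_sub_sq_le_of_tendsto_pow (hf : ∀ t, 0 ≤ f t) (hf1 : ∀ t, f t ≤ 1)
    (h : ∀ t : ℝ, Tendsto (fun p : ℕ × ℝ => f (p.2 / b p.1) ^ p.1) (atTop ×ˢ 𝓝 t)
      (𝓝 (Real.exp (-(c * |t| ^ α))))) {s : Set ℝ} (hs : IsCompact s)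
    (hα : 0 < α) :
    ∃ C : ℝ, 0 < C ∧ ∀ᶠ n : ℕ in atTop, ∀ t ∈ s, 1 - f (t / b n) ^ 2 ≤ C / n := by
  obtain ⟨ε, hε0, hε⟩ : ∃ ε : ℝ, 0 < ε ∧ ∀ t ∈ s, ε < Real.exp (-(c * |t| ^ α)) := by
    rcases s.eq_empty_or_nonempty with rfl | hne
    · exact ⟨1, one_pos, by simp⟩
    · obtain ⟨t₀, -, ht₀⟩ := hs.exists_isMinOn hne
        (f := fun t => Real.exp (-(c * |t| ^ α))) (by
          refine (Real.continuous_exp.comp (Continuous.neg (Continuous.mul continuous_const ?_))).continuousOn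
          exact continuous_abs.rpow_const fun x => Or.inr hα.le)
      refine ⟨Real.exp (-(c * |t₀| ^ α)) / 2, by positivity, fun t ht => ?_⟩
      have h1 : Real.exp (-(c * |t₀| ^ α)) ≤ Real.exp (-(c * |t| ^ α)) := ht₀ ht
      have := Real.exp_pos (-(c * |t₀| ^ α))
      linarith
  have hunif : ∀ᶠ n : ℕ in atTop, ∀ t ∈ s, ε < f (t / b n) ^ n := by
    have h1 : {p : ℕ × ℝ | ε < f (p.2 / b p.1) ^ p.1} ∈ atTop ×ˢ 𝓝ˢ s := by
      refine hs.mem_prod_nhdsSet_of_forall fun t ht => ?_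
      exact (h t).eventually_const_lt (hε t ht)
    obtain ⟨u, hu, v, hv, huv⟩ := mem_prod_iff.1 h1
    filter_upwards [hu] with n hn t ht
    exact huv (Set.mk_mem_prod hn (subset_of_mem_nhdsSet hv ht))
  refine ⟨2 * |Real.log ε| + 1, by positivity, ?_⟩
  filter_upwards [hunif, eventually_gt_atTop 0] with n hn hn0 t ht
  have hn0' : (0 : ℝ) < n := by exact_mod_cast hn0
  have h2 := hn t ht
  set y := f (t / b n) with hy
  have hy0 : 0 < y := by
    refine (hf _).lt_of_ne' fun h0 => ?_
    rw [← hy] at h0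
    rw [h0, zero_pow hn0.ne'] at h2
    linarith
  have h3 : Real.log ε ≤ n * Real.log y := by
    rw [← Real.log_pow]
    exact (Real.log_lt_log hε0 h2).le
  have h5 : 1 - y ≤ - Real.log y := by
    have := Real.log_le_sub_one_of_pos hy0
    linarith
  have h6 : 1 - y ^ 2 ≤ 2 * (- Real.log y) := by
    have := hf1 (t / b n)
    nlinarith
  rw [le_div_iff₀ hn0']
  have h7 : -|Real.log ε| ≤ Real.log ε := neg_abs_le _
  nlinarith

end

/-! ### Moments from characteristic functions -/

/-- A law with tails of order `x ^ (-β)` has finite absolute moments of every order `γ < β`. -/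
lemma integrable_abs_rpow_of_tail_le {η : Measure ℝ} [IsProbabilityMeasure η] {β γ C x₀ : ℝ}
    (hγ : 0 < γ) (hγβ : γ < β) (hx₀ : 0 < x₀)
    (h : ∀ x, x₀ < x → η.real {y | x < |y|} ≤ C * x ^ (-β)) :
    Integrable (fun y => |y| ^ γ) η := by
  have hmeas : Measurable fun y : ℝ => |y| ^ γ := by fun_prop
  refine ⟨hmeas.aestronglyMeasurable, ?_⟩
  rw [hasFiniteIntegral_iff_ofReal (ae_of_all _ fun y => by positivity),
    lintegral_rpow_eq_lintegral_meas_lt_mul η (ae_of_all _ fun y => abs_nonneg y)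
      (by fun_prop) hγ]
  refine ENNReal.mul_lt_top ENNReal.ofReal_lt_top ?_
  -- In the layer-cake integral, below `x₀` the probability is at most 1 and γ > 0 suffices; above
  -- it the tail bound and γ < β do.
  rw [← Set.Ioc_union_Ioi_eq_Ioi hx₀.le]
  refine (lintegral_union_le _ _ _).trans_lt (ENNReal.add_lt_top.2 ⟨?_, ?_⟩)
  · have h1 : IntegrableOn (fun t : ℝ => t ^ (γ - 1)) (Set.Ioc 0 x₀) := by
      rw [← intervalIntegrable_iff_integrableOn_Ioc_of_le hx₀.le]
      exact intervalIntegral.intervalIntegrable_rpow' (by linarith)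
    refine lt_of_le_of_lt ?_ h1.lintegral_lt_top
    refine lintegral_mono fun t => ?_
    calc η {a | t < |a|} * ENNReal.ofReal (t ^ (γ - 1))
        ≤ 1 * ENNReal.ofReal (t ^ (γ - 1)) := by gcongr; exact prob_le_one
      _ = _ := one_mul _
  · have h1 : IntegrableOn (fun t : ℝ => C * t ^ (γ - 1 - β)) (Set.Ioi x₀) :=
      (integrableOn_Ioi_rpow_of_lt (by linarith) hx₀).const_mul C
    refine lt_of_le_of_lt ?_ h1.lintegral_lt_top
    refine setLIntegral_mono' measurableSet_Ioi fun t ht => ?_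
    have ht0 : 0 < t := hx₀.trans ht
    rw [← ofReal_measureReal, ← ENNReal.ofReal_mul measureReal_nonneg]
    refine ENNReal.ofReal_le_ofReal ?_
    calc η.real {a | t < |a|} * t ^ (γ - 1) ≤ C * t ^ (-β) * t ^ (γ - 1) := by
          gcongr
          exact h t ht
      _ = C * t ^ (γ - 1 - β) := by
          rw [mul_assoc, ← Real.rpow_add ht0]
          ring_nf

/-- If the symmetrization of a law has a finite moment of order `γ ≥ 1`, so has the law. -/
lemma integrable_abs_rpow_of_conv_neg {ν : Measure ℝ} [IsProbabilityMeasure ν] {γ : ℝ}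
    (hγ : 1 ≤ γ) (h : Integrable (fun y => |y| ^ γ) (ν ∗ ν.map (fun x => -x))) :
    Integrable (fun y => |y| ^ γ) ν := by
  have hp : ENNReal.ofReal γ ≠ 0 := by simp; linarith
  have hp' : (ENNReal.ofReal γ).toReal = γ := ENNReal.toReal_ofReal (by linarith)
  have : IsProbabilityMeasure (ν.map (fun x => -x)) :=
    Measure.isProbabilityMeasure_map (by fun_prop)
  have hmeas : Measurable fun y : ℝ => |y| ^ γ := by fun_prop
  rw [Measure.conv, integrable_map_measure hmeas.aestronglyMeasurable (by fun_prop)] at h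
  -- Fubini gives one shift `x` for which y + x has the moment; subtracting a constant preserves it.
  obtain ⟨x, hx⟩ := h.prod_left_ae.exists
  have h1 : MemLp (fun y => y + x) (ENNReal.ofReal γ) ν := by
    rw [← integrable_norm_rpow_iff (by fun_prop) hp ENNReal.ofReal_ne_top, hp']
    exact hx
  have h2 : MemLp (fun y : ℝ => y) (ENNReal.ofReal γ) ν := by
    convert h1.sub (memLp_const x) using 1
    ext y
    simp
  have h3 := (integrable_norm_rpow_iff (by fun_prop) hp ENNReal.ofReal_ne_top).2 h2
  rw [hp'] at h3
  exact h3

/-- Truncation inequality for the symmetrized law, whose characteristic function is |φ|². The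
prefactor r/2 times the interval length 4/r gives the 2. -/
lemma measureReal_abs_gt_conv_neg_le {ν : Measure ℝ} [IsProbabilityMeasure ν] {r δ : ℝ}
    (hr : 0 < r) (h : ∀ t ∈ Set.Icc (-2 : ℝ) 2, 1 - ‖charFun ν (t / r)‖ ^ 2 ≤ δ) :
    (ν ∗ ν.map (fun x => -x)).real {x | r < |x|} ≤ 2 * δ := by
  have : IsProbabilityMeasure (ν.map (fun x => -x)) :=
    Measure.isProbabilityMeasure_map (by fun_prop)
  refine (measureReal_abs_gt_le_integral_charFun hr).trans ?_
  have hδ : ∀ t ∈ Set.uIoc (-2 * r⁻¹) (2 * r⁻¹),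
      ‖1 - charFun (ν ∗ ν.map (fun x => -x)) t‖ ≤ δ := by
    intro t ht
    have hr' := inv_pos.2 hr
    rw [Set.uIoc_of_le (by nlinarith)] at ht
    have h1 := h (t * r) ⟨by
      have := mul_le_mul_of_nonneg_right ht.1.le hr.le
      rwa [mul_assoc, inv_mul_cancel₀ hr.ne', mul_one] at this, by
      have := mul_le_mul_of_nonneg_right ht.2 hr.le
      rwa [mul_assoc, inv_mul_cancel₀ hr.ne', mul_one] at this⟩
    rw [mul_div_cancel_right₀ _ hr.ne'] at h1
    rw [charFun_conv_map_neg, ← Complex.ofReal_one, ← Complex.ofReal_sub, Complex.norm_real,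
      Real.norm_of_nonneg]
    · exact h1
    · have := norm_charFun_le_one (μ := ν) t
      have := norm_nonneg (charFun ν t)
      nlinarith
  have h2 := intervalIntegral.norm_integral_le_of_norm_le_const hδ
  have h3 : |2 * r⁻¹ - -2 * r⁻¹| = 4 * r⁻¹ := by
    rw [abs_of_nonneg] <;> ring_nf
    positivity
  rw [h3] at h2
  calc 2⁻¹ * r * _ ≤ 2⁻¹ * r * (δ * (4 * r⁻¹)) := by gcongr
    _ = 2 * δ := by field_simp; ring

/-- Moments of a law from the decay of its characteristic function along norming constants of
polynomial growth. -/
lemma integrable_abs_rpow_of_one_sub_sq_le {ν : Measure ℝ} [IsProbabilityMeasure ν] {b : ℕ → ℝ}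
    {K C s γ : ℝ} (hK : 0 < K) (hC : 0 < C) (hb : ∀ᶠ n in atTop, 0 < b n)
    (hbK : ∀ᶠ n : ℕ in atTop, b n ≤ K * (n : ℝ) ^ s)
    (h : ∀ᶠ n : ℕ in atTop, ∀ t ∈ Set.Icc (-2 : ℝ) 2, 1 - ‖charFun ν (t / b n)‖ ^ 2 ≤ C / n)
    (hs : 0 < s) (hγ : 1 ≤ γ) (hγs : γ < 1 / s) :
    Integrable (fun y => |y| ^ γ) ν := by
  have : IsProbabilityMeasure (ν.map (fun x => -x)) :=
    Measure.isProbabilityMeasure_map (by fun_prop)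
  refine integrable_abs_rpow_of_conv_neg hγ ?_
  obtain ⟨N₀, hN₀⟩ := eventually_atTop.1 (hb.and (hbK.and h))
  set N := N₀ + 1 with hN
  have hN' : (0 : ℝ) < N := by positivity
  refine integrable_abs_rpow_of_tail_le (β := 1 / s) (C := 4 * C * K ^ (1 / s))
    (x₀ := K * (N : ℝ) ^ s) (by linarith) hγs (by positivity) fun x hx => ?_
  have hx0 : 0 < x := lt_trans (by positivity) hx
  -- The floor of `y` is the largest n with K n^s ≤ x, so b_n ≤ x, and the tail beyond x is O(1/n) =
  -- O(x^(-1/s)).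
  set y : ℝ := (x / K) ^ (1 / s) with hy
  have hNy : (N : ℝ) < y := by
    have h1 : (N : ℝ) ^ s < x / K := by rwa [lt_div_iff₀ hK, mul_comm]
    have h2 := Real.rpow_lt_rpow (by positivity) h1 (one_div_pos.2 hs)
    rwa [one_div, Real.rpow_rpow_inv hN'.le hs.ne', ← one_div] at h2
  have hy0 : 0 < y := hN'.trans hNy
  set n := ⌊y⌋₊ with hn
  have hNn : N ≤ n := Nat.le_floor hNy.le
  have hny : (n : ℝ) ≤ y := Nat.floor_le hy0.le
  have hyn : y ≤ 2 * n := by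
    have h1 := Nat.lt_floor_add_one y
    have h2 : (1 : ℝ) ≤ n := by exact_mod_cast (by omega : 1 ≤ n)
    linarith
  have hn0 : (0 : ℝ) < n := by linarith
  obtain ⟨hb0, hbn, hcf⟩ := hN₀ n (by omega)
  have hbx : b n ≤ x := by
    refine hbn.trans ?_
    have h1 : (n : ℝ) ^ s ≤ y ^ s := Real.rpow_le_rpow hn0.le hny hs.le
    rw [hy, one_div, Real.rpow_inv_rpow (by positivity) hs.ne', le_div_iff₀ hK] at h1
    linarith
  calc (ν ∗ ν.map (fun x => -x)).real {z | x < |z|}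
      ≤ (ν ∗ ν.map (fun x => -x)).real {z | b n < |z|} :=
        measureReal_mono fun z hz => hbx.trans_lt hz
    _ ≤ 2 * (C / n) := measureReal_abs_gt_conv_neg_le hb0 hcf
    _ ≤ 4 * C / y := by
        rw [← mul_div_assoc, div_le_div_iff₀ hn0 hy0]
        nlinarith
    _ = 4 * C * K ^ (1 / s) * x ^ (-(1 / s)) := by
        rw [hy, Real.div_rpow hx0.le hK.le, Real.rpow_neg hx0.le]
        field_simp

/-! ### Deterministic estimates for the edge probabilities -/

lemma sub_div_one_add_le_rpow {x β : ℝ} (hx : 0 ≤ x) (hβ : 1 ≤ β) (hβ' : β ≤ 2) :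
    x - x / (1 + x) ≤ x ^ β := by
  -- The difference is at most min(x², x), and x^β dominates this minimum for 1 ≤ β ≤ 2.
  have h1 : x - x / (1 + x) = x ^ 2 / (1 + x) := by field_simp; ring
  rcases le_total x 1 with h | h
  · rcases hx.eq_or_lt with rfl | hx0
    · simp [Real.zero_rpow (by linarith : β ≠ 0)]
    · calc x - x / (1 + x) = x ^ 2 / (1 + x) := h1
        _ ≤ x ^ 2 := div_le_self (by positivity) (by linarith)
        _ = x ^ (2 : ℝ) := by norm_cast
        _ ≤ x ^ β := Real.rpow_le_rpow_of_exponent_ge hx0 h hβ'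
  · calc x - x / (1 + x) ≤ x := sub_le_self _ (by positivity)
      _ = x ^ (1 : ℝ) := (Real.rpow_one x).symm
      _ ≤ x ^ β := Real.rpow_le_rpow_of_exponent_le h hβ

/-- Meant for the diagonal with exponent β/2: there (w_i²)^(β/2) = w_i^β, so no moment beyond order
β is needed. -/
lemma div_one_add_le_rpow {x s : ℝ} (hx : 0 ≤ x) (hs : 0 < s) (hs' : s ≤ 1) :
    x / (1 + x) ≤ x ^ s := by
  rcases le_total x 1 with h | h
  · rcases hx.eq_or_lt with rfl | hx0
    · simp [Real.zero_rpow hs.ne']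
    · calc x / (1 + x) ≤ x := div_le_self hx (by linarith)
        _ = x ^ (1 : ℝ) := (Real.rpow_one x).symm
        _ ≤ x ^ s := Real.rpow_le_rpow_of_exponent_ge hx0 h hs'
  · calc x / (1 + x) ≤ 1 := div_le_one_of_le₀ (by linarith) (by linarith)
      _ ≤ x ^ s := Real.one_le_rpow h hs.le

section

variable {n : ℕ} {w : Fin n → ℝ}

lemma edgeProb_comm (w : Fin n → ℝ) (i j : Fin n) : edgeProb w i j = edgeProb w j i := by
  simp only [edgeProb, mul_comm (w i)]

lemma edgeProb_nonneg (hw : ∀ i, 0 ≤ w i) (i j : Fin n) : 0 ≤ edgeProb w i j := by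
  have : 0 ≤ ∑ k, w k := Finset.sum_nonneg fun k _ => hw k
  have := mul_nonneg (hw i) (hw j)
  unfold edgeProb
  positivity

/-- This form of the total weight lets it be compared with the edge probabilities term by term. -/
lemma sum_eq_sum_mul_div_sum (w : Fin n → ℝ) (hL : 0 < ∑ k, w k) :
    ∑ k, w k = ∑ i, ∑ j, w i * w j / ∑ k, w k := by
  simp_rw [← Finset.sum_div]
  rw [← Finset.sum_mul_sum]
  field_simp

lemma edgeProb_le_mul_div_sum (hw : ∀ i, 0 ≤ w i) (hL : 0 < ∑ k, w k) (i j : Fin n) :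
    edgeProb w i j ≤ w i * w j / ∑ k, w k := by
  have := mul_nonneg (hw i) (hw j)
  unfold edgeProb
  gcongr
  linarith

lemma sum_sum_edgeProb_le (hw : ∀ i, 0 ≤ w i) : ∑ i, ∑ j, edgeProb w i j ≤ ∑ k, w k := by
  rcases (Finset.sum_nonneg fun k _ => hw k : 0 ≤ ∑ k, w k).eq_or_lt with hL | hL
  · rw [← hL]
    have h0 : ∀ i, w i = 0 := fun i =>
      (Finset.sum_eq_zero_iff_of_nonneg fun k _ => hw k).1 hL.symm i (Finset.mem_univ i)
    simp [edgeProb, h0]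
  · conv_rhs => rw [sum_eq_sum_mul_div_sum w hL]
    gcongr with i _ j _
    exact edgeProb_le_mul_div_sum hw hL i j

/-- The total weight exceeds the expected degree sum by little. -/
lemma abs_sum_edgeProb_offDiag_sub_le (hw : ∀ i, 0 ≤ w i) (hL : 0 < ∑ k, w k) {β : ℝ}
    (hβ : 1 ≤ β) (hβ' : β ≤ 2) :
    |(∑ i, ∑ j, if i = j then 0 else edgeProb w i j) - ∑ k, w k|
      ≤ (∑ k, w k ^ β) ^ 2 * (∑ k, w k) ^ (-β) + (∑ k, w k ^ β) * (∑ k, w k) ^ (-(β / 2)) := by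
  set L := ∑ k, w k with hLdef
  have h0 : ∀ i j, 0 ≤ w i * w j := fun i j => mul_nonneg (hw i) (hw j)
  have hx : ∀ i j, edgeProb w i j = (w i * w j / L) / (1 + w i * w j / L) := by
    intro i j
    have := h0 i j
    simp only [edgeProb, ← hLdef]
    field_simp
  have hsplit : (∑ i, ∑ j, if i = j then 0 else edgeProb w i j)
      = (∑ i, ∑ j, edgeProb w i j) - ∑ i, edgeProb w i i := by
    rw [← Finset.sum_sub_distrib]
    refine Finset.sum_congr rfl fun i _ => ?_
    rw [eq_sub_iff_add_eq, ← Finset.sum_erase_add _ _ (Finset.mem_univ i),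
      ← Finset.sum_erase_add (f := fun j => edgeProb w i j) _ (Finset.mem_univ i)]
    simp only [if_true, add_zero]
    congr 1
    refine Finset.sum_congr rfl fun j hj => ?_
    rw [if_neg (Finset.ne_of_mem_erase hj).symm]
  have hle := sum_sum_edgeProb_le hw
  have hdiag0 : 0 ≤ ∑ i, edgeProb w i i := Finset.sum_nonneg fun i _ => edgeProb_nonneg hw i i
  have hmain : L - (∑ i, ∑ j, edgeProb w i j) ≤ (∑ k, w k ^ β) ^ 2 * L ^ (-β) := by
    conv_lhs => rw [hLdef, sum_eq_sum_mul_div_sum w hL, ← hLdef]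
    rw [← Finset.sum_sub_distrib, sq, Finset.sum_mul_sum, Finset.sum_mul]
    gcongr with i _
    rw [← Finset.sum_sub_distrib, Finset.sum_mul]
    gcongr with j _
    rw [hx]
    refine (sub_div_one_add_le_rpow (div_nonneg (h0 i j) hL.le) hβ hβ').trans_eq ?_
    rw [Real.div_rpow (h0 i j) hL.le, Real.mul_rpow (hw i) (hw j), Real.rpow_neg hL.le,
      div_eq_mul_inv]
  have hdiag : ∑ i, edgeProb w i i ≤ (∑ k, w k ^ β) * L ^ (-(β / 2)) := by
    rw [Finset.sum_mul]
    gcongr with i _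
    rw [hx]
    refine (div_one_add_le_rpow (s := β / 2) (div_nonneg (h0 i i) hL.le) (by linarith)
      (by linarith)).trans_eq ?_
    rw [Real.div_rpow (h0 i i) hL.le, Real.mul_rpow (hw i) (hw i), Real.rpow_neg hL.le,
      div_eq_mul_inv, ← Real.rpow_add_of_nonneg (hw i) (by linarith) (by linarith), add_halves]
  rw [hsplit, abs_le]
  constructor
  · linarith
  · have : 0 ≤ (∑ k, w k ^ β) ^ 2 * L ^ (-β) := by positivity
    linarith

open Classical in
/-- Twice the number of edges is the number of ordered pairs of adjacent vertices. -/
lemma SimpleGraph.two_mul_ncard_edgeSet (G : SimpleGraph (Fin n)) :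
    2 * G.edgeSet.ncard = ∑ i, ∑ j, if G.Adj i j then 1 else 0 := by
  rw [← SimpleGraph.coe_edgeFinset, Set.ncard_coe_finset, ← G.sum_degrees_eq_twice_card_edges]
  refine Finset.sum_congr rfl fun i _ => ?_
  rw [← SimpleGraph.card_neighborFinset_eq_degree, Finset.sum_boole]
  simp [SimpleGraph.neighborFinset_eq_filter]

lemma sum_sum_eq_two_mul_sum_filter_lt (g : Fin n → Fin n → ℝ) (hg : ∀ i j, g i j = g j i)
    (hg0 : ∀ i, g i i = 0) :
    ∑ i, ∑ j, g i j = 2 * ∑ e : Fin n × Fin n with e.1 < e.2, g e.1 e.2 := by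
  rw [← Fintype.sum_prod_type', two_mul]
  have hswap : ∑ e : Fin n × Fin n with e.1 < e.2, g e.1 e.2
      = ∑ e : Fin n × Fin n with e.2 < e.1, g e.1 e.2 := by
    refine Finset.sum_equiv (Equiv.prodComm _ _) (by simp) fun e _ => ?_
    simpa using hg e.1 e.2
  nth_rewrite 2 [hswap]
  rw [Finset.sum_filter, Finset.sum_filter, ← Finset.sum_add_distrib]
  refine Finset.sum_congr rfl fun e _ => ?_
  rcases lt_trichotomy e.1 e.2 with h | h | h
  · simp [h, h.le]
  · simp [h, hg0]
  · simp [h, h.le]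
end

/-! ### Conditional variance of the edge count -/

section

variable {Ω : Type*} {m mΩ : MeasurableSpace Ω} {P : Measure Ω}

lemma indicator_one_nonneg_le_one (A : Set Ω) :
    ∀ᵐ ω ∂P, 0 ≤ A.indicator (fun _ => (1 : ℝ)) ω ∧ A.indicator (fun _ => (1 : ℝ)) ω ≤ 1 :=
  ae_of_all _ fun ω => ⟨Set.indicator_nonneg (fun _ _ => zero_le_one) ω,
    Set.indicator_le_self' (fun _ _ => zero_le_one) ω⟩

variable [IsProbabilityMeasure P]

lemma condProb_nonneg_le_one (hm : m ≤ mΩ) {A : Set Ω} (hA : MeasurableSet A) :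
    ∀ᵐ ω ∂P, 0 ≤ (P⟦A | m⟧) ω ∧ (P⟦A | m⟧) ω ≤ 1 := by
  have hint : Integrable (A.indicator fun _ => (1 : ℝ)) P := (integrable_const 1).indicator hA
  have h1 := condExp_mono (m := m) (integrable_zero Ω ℝ P) hint
    (ae_of_all _ fun ω => Set.indicator_nonneg (fun _ _ => zero_le_one) ω)
  have h2 := condExp_mono (m := m) hint (integrable_const (1 : ℝ))
    (ae_of_all _ fun ω => Set.indicator_le_self' (fun _ _ => zero_le_one) ω)
  rw [condExp_const hm] at h2
  rw [condExp_zero] at h1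
  filter_upwards [h1, h2] with ω h1 h2 using ⟨h1, h2⟩

lemma integrable_mul_of_bound {g h : Ω → ℝ} (hg : AEStronglyMeasurable g P)
    (hh : AEStronglyMeasurable h P) (hg1 : ∀ᵐ ω ∂P, 0 ≤ g ω ∧ g ω ≤ 1)
    (hh1 : ∀ᵐ ω ∂P, 0 ≤ h ω ∧ h ω ≤ 1) : Integrable (fun ω => g ω * h ω) P := by
  refine Integrable.of_bound (hg.mul hh) 1 ?_
  filter_upwards [hg1, hh1] with ω h1 h2
  rw [Real.norm_of_nonneg (mul_nonneg h1.1 h2.1)]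
  exact mul_le_one₀ h1.2 h2.1 h2.2

/-- The second factor is m-measurable and can be pulled out of the conditional expectation. In a
covariance, the cross terms thus reduce to products of conditional probabilities. -/
lemma integral_indicator_mul_condProb (hm : m ≤ mΩ) {A B : Set Ω} (hA : MeasurableSet A)
    (hB : MeasurableSet B) :
    ∫ ω, A.indicator (fun _ => (1 : ℝ)) ω * (P⟦B | m⟧) ω ∂P
      = ∫ ω, (P⟦A | m⟧) ω * (P⟦B | m⟧) ω ∂P := by
  have hint : Integrable (A.indicator fun _ => (1 : ℝ)) P := (integrable_const 1).indicator hA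
  have h1 : Integrable (fun ω => A.indicator (fun _ => (1 : ℝ)) ω * (P⟦B | m⟧) ω) P :=
    integrable_mul_of_bound hint.1 integrable_condExp.1 (indicator_one_nonneg_le_one A)
      (condProb_nonneg_le_one hm hB)
  have h2 := condExp_mul_of_stronglyMeasurable_right (m := m) (μ := P)
    (f := A.indicator fun _ => (1 : ℝ)) (g := P⟦B | m⟧) stronglyMeasurable_condExp h1 hint
  rw [← integral_condExp hm]
  exact integral_congr_ae h2

/-- Conditionally centered indicators of pairwise conditionally independent events: the variance
of their sum is at most the expected number of events that occur. -/
lemma integral_sq_sum_indicator_sub_condProb_le (hm : m ≤ mΩ) {ι : Type*} [DecidableEq ι]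
    {A : ι → Set Ω} (s : Finset ι) (hA : ∀ e, MeasurableSet (A e))
    (hind : ∀ e ∈ s, ∀ f ∈ s, e ≠ f → P⟦A e ∩ A f | m⟧ =ᵐ[P] P⟦A e | m⟧ * P⟦A f | m⟧) :
    Integrable (fun ω => (∑ e ∈ s, ((A e).indicator (fun _ => (1 : ℝ)) ω - (P⟦A e | m⟧) ω)) ^ 2) P ∧
    ∫ ω, (∑ e ∈ s, ((A e).indicator (fun _ => (1 : ℝ)) ω - (P⟦A e | m⟧) ω)) ^ 2 ∂P
      ≤ ∑ e ∈ s, ∫ ω, (P⟦A e | m⟧) ω ∂P := by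
  set I : ι → Ω → ℝ := fun e => (A e).indicator fun _ => (1 : ℝ) with hI
  set q : ι → Ω → ℝ := fun e => P⟦A e | m⟧ with hq
  have hIint : ∀ e, Integrable (I e) P := fun e => (integrable_const 1).indicator (hA e)
  have hqint : ∀ e, Integrable (q e) P := fun e => integrable_condExp
  have hI1 : ∀ e, ∀ᵐ ω ∂P, 0 ≤ I e ω ∧ I e ω ≤ 1 := fun e => indicator_one_nonneg_le_one (A e)
  have hq1 : ∀ e, ∀ᵐ ω ∂P, 0 ≤ q e ω ∧ q e ω ≤ 1 := fun e => condProb_nonneg_le_one hm (hA e)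
  have hII : ∀ e f, Integrable (fun ω => I e ω * I f ω) P := fun e f =>
    integrable_mul_of_bound (hIint e).1 (hIint f).1 (hI1 e) (hI1 f)
  have hIq : ∀ e f, Integrable (fun ω => I e ω * q f ω) P := fun e f =>
    integrable_mul_of_bound (hIint e).1 (hqint f).1 (hI1 e) (hq1 f)
  have hqq : ∀ e f, Integrable (fun ω => q e ω * q f ω) P := fun e f =>
    integrable_mul_of_bound (hqint e).1 (hqint f).1 (hq1 e) (hq1 f)
  have hexp : ∀ e f ω, (I e ω - q e ω) * (I f ω - q f ω)
      = I e ω * I f ω - I e ω * q f ω - I f ω * q e ω + q e ω * q f ω := fun e f ω => by ring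
  have hint : ∀ e f, Integrable (fun ω => (I e ω - q e ω) * (I f ω - q f ω)) P := by
    intro e f
    simp_rw [hexp]
    exact (((hII e f).sub (hIq e f)).sub (hIq f e)).add (hqq e f)
  have hcov : ∀ e f, ∫ ω, (I e ω - q e ω) * (I f ω - q f ω) ∂P
      = ∫ ω, I e ω * I f ω ∂P - ∫ ω, q e ω * q f ω ∂P := by
    intro e f
    have h1 : Integrable (fun ω => I e ω * I f ω - I e ω * q f ω) P := (hII e f).sub (hIq e f)
    have h2 : Integrable (fun ω => I e ω * I f ω - I e ω * q f ω - I f ω * q e ω) P :=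
      h1.sub (hIq f e)
    simp_rw [hexp]
    rw [integral_add h2 (hqq e f), integral_sub h1 (hIq f e), integral_sub (hII e f) (hIq e f),
      integral_indicator_mul_condProb hm (hA e) (hA f),
      integral_indicator_mul_condProb hm (hA f) (hA e)]
    simp only [mul_comm ((P⟦A f | m⟧) _), hq]
    ring
  -- Conditional independence makes distinct centered indicators uncorrelated, so only the diagonal
  -- contributes, with 𝔼q - 𝔼q² ≤ 𝔼q.
  have hoff : ∀ e ∈ s, ∀ f ∈ s, e ≠ f → ∫ ω, (I e ω - q e ω) * (I f ω - q f ω) ∂P = 0 := by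
    intro e he f hf hef
    have h1 : ∫ ω, I e ω * I f ω ∂P = ∫ ω, (A e ∩ A f).indicator (fun _ => (1 : ℝ)) ω ∂P := by
      congr 1
      ext ω
      have := congrFun (Set.inter_indicator_one (s := A e) (t := A f) (M₀ := ℝ)) ω
      exact this.symm
    have h2 : ∫ ω, (P⟦A e ∩ A f | m⟧) ω ∂P = ∫ ω, q e ω * q f ω ∂P :=
      integral_congr_ae (hind e he f hf hef)
    rw [hcov, h1, ← integral_condExp hm, h2, sub_self]
  have hdiag : ∀ e, ∫ ω, (I e ω - q e ω) * (I e ω - q e ω) ∂P ≤ ∫ ω, q e ω ∂P := by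
    intro e
    have h1 : ∫ ω, I e ω * I e ω ∂P = ∫ ω, q e ω ∂P := by
      rw [hq, integral_condExp hm]
      congr 1
      ext ω
      by_cases h : ω ∈ A e <;> simp [hI, h]
    rw [hcov, h1]
    have : 0 ≤ ∫ ω, q e ω * q e ω ∂P := integral_nonneg fun ω => mul_self_nonneg _
    linarith
  have hsq : ∀ ω, (∑ e ∈ s, (I e ω - q e ω)) ^ 2
      = ∑ e ∈ s, ∑ f ∈ s, (I e ω - q e ω) * (I f ω - q f ω) := fun ω => by
    rw [sq, Finset.sum_mul_sum]
  constructor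
  · change Integrable (fun ω => (∑ e ∈ s, (I e ω - q e ω)) ^ 2) P
    simp_rw [hsq]
    exact integrable_finsetSum _ fun e _ => integrable_finsetSum _ fun f _ => hint e f
  · change ∫ ω, (∑ e ∈ s, (I e ω - q e ω)) ^ 2 ∂P ≤ ∑ e ∈ s, ∫ ω, q e ω ∂P
    simp_rw [hsq]
    rw [integral_finsetSum _ fun e _ => integrable_finsetSum _ fun f _ => hint e f]
    refine Finset.sum_le_sum fun e he => ?_
    rw [integral_finsetSum _ fun f _ => hint e f, Finset.sum_eq_single_of_mem e he
      fun f hf hfe => hoff e he f hf hfe.symm]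
    exact hdiag e

end

open Classical in
/-- The edge count of a generalized random graph is close to its conditional mean. -/
lemma IsGeneralizedRandomGraph.integral_sq_le {Ω : Type*} {m mΩ : MeasurableSpace Ω}
    {P : Measure Ω} [IsProbabilityMeasure P] {n : ℕ} {W : Fin n → Ω → ℝ}
    (hmW : m = MeasurableSpace.comap (fun ω k => W k ω) inferInstance)
    (hW_meas : ∀ i, Measurable (W i))
    (hW_nonneg : ∀ i, ∀ᵐ ω ∂P, 0 ≤ W i ω) (hW_int : ∀ i, Integrable (W i) P)
    {G : Ω → SimpleGraph (Fin n)} (hG : IsGeneralizedRandomGraph P W G) :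
    Integrable (fun ω => (2 * ((G ω).edgeSet.ncard : ℝ)
      - ∑ i, ∑ j, if i = j then 0 else edgeProb (fun k => W k ω) i j) ^ 2) P ∧
    ∫ ω, (2 * ((G ω).edgeSet.ncard : ℝ)
      - ∑ i, ∑ j, if i = j then 0 else edgeProb (fun k => W k ω) i j) ^ 2 ∂P
      ≤ 2 * ∑ i, ∫ ω, W i ω ∂P := by
  have hm : m ≤ mΩ := hmW ▸ (measurable_pi_lambda _ hW_meas).comap_le
  have hprob := hG.condProb_adj
  have hcond := hG.condIndep
  rw [← hmW] at hprob hcond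
  set A : Fin n × Fin n → Set Ω := fun e => {ω | (G ω).Adj e.1 e.2} with hA_def
  have hA : ∀ e, MeasurableSet (A e) := fun e => hG.measurableSet_adj e.1 e.2
  set s : Finset (Fin n × Fin n) := Finset.univ.filter fun e => e.1 < e.2 with hs
  have hmem : ∀ e, e ∈ s ↔ e.1 < e.2 := fun e => by simp [hs]
  have hind : ∀ e ∈ s, ∀ f ∈ s, e ≠ f →
      P⟦A e ∩ A f | m⟧ =ᵐ[P] P⟦A e | m⟧ * P⟦A f | m⟧ := by
    intro e he f hf hef
    have h1 := hcond {e, f} (by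
      intro x hx
      rcases Finset.mem_insert.1 hx with rfl | hx
      · exact (hmem _).1 he
      · rw [Finset.mem_singleton.1 hx]
        exact (hmem _).1 hf)
    rw [Finset.prod_pair hef] at h1
    simpa using h1
  have hp : ∀ᵐ ω ∂P, ∀ e ∈ s, (P⟦A e | m⟧) ω = edgeProb (fun k => W k ω) e.1 e.2 := by
    rw [ae_all_iff]
    intro e
    by_cases he : e ∈ s
    · filter_upwards [hprob e.1 e.2 ((hmem e).1 he)] with ω hω _
      exact hω
    · exact ae_of_all _ fun ω h => absurd h he
  have hN : ∀ ω, 2 * ((G ω).edgeSet.ncard : ℝ)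
      = 2 * ∑ e ∈ s, (A e).indicator (fun _ => (1 : ℝ)) ω := by
    intro ω
    have h1 := (G ω).two_mul_ncard_edgeSet
    have h2 := sum_sum_eq_two_mul_sum_filter_lt
      (fun i j => if (G ω).Adj i j then (1 : ℝ) else 0)
      (fun i j => by simp only [SimpleGraph.adj_comm]) (fun i => by simp)
    have h3 : 2 * ((G ω).edgeSet.ncard : ℝ) = ∑ i, ∑ j, if (G ω).Adj i j then (1 : ℝ) else 0 := by
      exact_mod_cast h1
    rw [h3, h2]
    congr 1
  have hQ : ∀ ω, (∑ i, ∑ j, if i = j then 0 else edgeProb (fun k => W k ω) i j)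
      = 2 * ∑ e ∈ s, edgeProb (fun k => W k ω) e.1 e.2 := by
    intro ω
    rw [sum_sum_eq_two_mul_sum_filter_lt _ (fun i j => by
      simp only [eq_comm, edgeProb_comm]) (fun i => by simp)]
    congr 1
    refine Finset.sum_congr rfl fun e he => ?_
    rw [if_neg ((hmem e).1 he).ne]
  have hae : (fun ω => (2 * ((G ω).edgeSet.ncard : ℝ)
      - ∑ i, ∑ j, if i = j then 0 else edgeProb (fun k => W k ω) i j) ^ 2) =ᵐ[P]
      fun ω => 4 * (∑ e ∈ s, ((A e).indicator (fun _ => (1 : ℝ)) ω - (P⟦A e | m⟧) ω)) ^ 2 := by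
    filter_upwards [hp] with ω hω
    rw [hN, hQ, Finset.sum_sub_distrib, Finset.sum_congr rfl hω]
    ring
  obtain ⟨h1, h2⟩ := integral_sq_sum_indicator_sub_condProb_le hm s hA hind
  refine ⟨(h1.const_mul 4).congr hae.symm, ?_⟩
  rw [integral_congr_ae hae, integral_const_mul]
  -- The sum over i < j is half of that over i ≠ j, hence at most L/2; with the factor 4 from
  -- doubling the edge count this gives 2.
  have h3 : ∑ e ∈ s, ∫ ω, (P⟦A e | m⟧) ω ∂P ≤ 2⁻¹ * ∑ i, ∫ ω, W i ω ∂P := by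
    rw [← integral_finsetSum _ fun e _ => integrable_condExp,
      ← integral_finsetSum _ fun i _ => hW_int i, ← integral_const_mul]
    refine integral_mono_ae (integrable_finsetSum _ fun e _ => integrable_condExp)
      ((integrable_finsetSum _ fun i _ => hW_int i).const_mul _) ?_
    filter_upwards [hp, ae_all_iff.2 hW_nonneg] with ω hω hω0
    have h4 := hQ ω
    have h5 := sum_sum_edgeProb_le hω0
    have h6 : (∑ i, ∑ j, if i = j then 0 else edgeProb (fun k => W k ω) i j)
        ≤ ∑ i, ∑ j, edgeProb (fun k => W k ω) i j := by
      gcongr with i _ j _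
      split_ifs
      · exact edgeProb_nonneg hω0 i j
      · exact le_rfl
    rw [Finset.sum_congr rfl hω]
    linarith
  linarith

/-! ### Negligibility of the error terms -/

lemma tendsto_mul_rpow_neg_div_of_tendsto_div {L V a : ℕ → ℝ} {ℓ v K s β : ℝ} (k : ℕ)
    (hL0 : ∀ n, 0 ≤ L n) (hℓ : 0 < ℓ) (hL : Tendsto (fun n => L n / n) atTop (𝓝 ℓ))
    (hV : Tendsto (fun n => V n / n) atTop (𝓝 v)) (hK : 0 < K)
    (ha : ∀ᶠ n : ℕ in atTop, K * (n : ℝ) ^ s ≤ |a n|) (hs : k - β < s) :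
    Tendsto (fun n => V n ^ k * L n ^ (-β) / a n) atTop (𝓝 0) := by
  have h1 : Tendsto (fun n : ℕ => |(V n / n) ^ k * (L n / n) ^ (-β)| * K⁻¹ *
      ((n : ℝ) ^ (-(s - (k - β))))) atTop (𝓝 0) := by
    have h2 := (((hV.pow k).mul (hL.rpow_const (p := -β) (Or.inl hℓ.ne'))).abs.mul_const K⁻¹).mul
      ((tendsto_rpow_neg_atTop (sub_pos.2 hs)).comp tendsto_natCast_atTop_atTop)
    simpa [Function.comp_def] using h2
  refine squeeze_zero_norm' ?_ h1
  filter_upwards [ha, eventually_gt_atTop 0] with n hn hn0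
  have hn0' : (0 : ℝ) < n := by exact_mod_cast hn0
  have ha0 : 0 < |a n| := lt_of_lt_of_le (by positivity) hn
  -- After normalizing by n, the numerator is a convergent factor times n^(k-β), which n^s beats.
  have h3 : V n ^ k * L n ^ (-β) = (V n / n) ^ k * (L n / n) ^ (-β) * (n : ℝ) ^ (k - β) := by
    rw [Real.div_rpow (hL0 n) hn0'.le, div_pow, Real.rpow_sub hn0', Real.rpow_natCast,
      Real.rpow_neg hn0'.le]
    field_simp
  rw [norm_div, Real.norm_eq_abs, Real.norm_eq_abs, h3, abs_mul,
    abs_of_nonneg (a := (n : ℝ) ^ (k - β)) (by positivity), div_le_iff₀ ha0, neg_sub,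
    Real.rpow_sub hn0' (k - β)]
  have hy : 0 ≤ (n : ℝ) ^ (k - β) := by positivity
  generalize (n : ℝ) ^ (k - β) = y at *
  calc _ = |(V n / n) ^ k * (L n / n) ^ (-β)| * K⁻¹ * (y / n ^ s) * (K * n ^ s) := by
        field_simp
    _ ≤ _ := by gcongr

/-- Chebyshev: the probability is O(n / a_n²) = O(n^(1-2s)), which vanishes because s > 1/2. -/
lemma tendstoInMeasure_div_of_integral_sq_le {Ω : Type*} [MeasurableSpace Ω] {P : Measure Ω}
    [IsProbabilityMeasure P] {X : ℕ → Ω → ℝ} {a : ℕ → ℝ} {C K s : ℝ} (hK : 0 < K) (hs : 1 / 2 < s)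
    (ha : ∀ᶠ n : ℕ in atTop, K * (n : ℝ) ^ s ≤ |a n|)
    (hint : ∀ n, Integrable (fun ω => X n ω ^ 2) P) (hX : ∀ n : ℕ, ∫ ω, X n ω ^ 2 ∂P ≤ C * n) :
    TendstoInMeasure P (fun n ω => X n ω / a n) atTop (fun _ => 0) := by
  rw [tendstoInMeasure_iff_measureReal_norm]
  intro ε hε
  have h1 : Tendsto (fun n : ℕ => C * (ε ^ 2 * K ^ 2)⁻¹ * (n : ℝ) ^ (-(2 * s - 1))) atTop (𝓝 0) := by
    have h2 := ((tendsto_rpow_neg_atTop (by linarith : 0 < 2 * s - 1)).comp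
      tendsto_natCast_atTop_atTop).const_mul (C * (ε ^ 2 * K ^ 2)⁻¹)
    simpa only [mul_zero, Function.comp_def] using h2
  refine squeeze_zero' (Eventually.of_forall fun n => measureReal_nonneg) ?_ h1
  filter_upwards [ha, eventually_gt_atTop 0] with n hn hn0
  have hn0' : (0 : ℝ) < n := by exact_mod_cast hn0
  have ha0 : 0 < |a n| := lt_of_lt_of_le (by positivity) hn
  have h2 := mul_meas_ge_le_integral_of_nonneg (ae_of_all P fun ω => sq_nonneg (X n ω)) (hint n)
    (ε ^ 2 * |a n| ^ 2)
  have h3 : {ω | ε ≤ ‖X n ω / a n - 0‖} = {ω | ε ^ 2 * |a n| ^ 2 ≤ X n ω ^ 2} := by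
    ext ω
    rw [Set.mem_ofPred_eq, Set.mem_ofPred_eq, sub_zero, norm_div, Real.norm_eq_abs, Real.norm_eq_abs,
      le_div_iff₀ ha0, ← mul_pow, ← sq_abs (X n ω), sq_le_sq₀ (by positivity) (abs_nonneg _)]
  have h4 : K ^ 2 * (n : ℝ) ^ (2 * s) ≤ |a n| ^ 2 := by
    have h5 := pow_le_pow_left₀ (by positivity) hn 2
    rwa [mul_pow, ← Real.rpow_natCast ((n : ℝ) ^ s), ← Real.rpow_mul hn0'.le, mul_comm s] at h5
  have h6 : (ε ^ 2 * (K ^ 2 * (n : ℝ) ^ (2 * s))) * P.real {ω | ε ≤ ‖X n ω / a n - 0‖} ≤ C * n := by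
    rw [h3]
    refine le_trans ?_ (h2.trans (hX n))
    gcongr
  have h7 : (n : ℝ) ^ (-(2 * s - 1)) = n / n ^ (2 * s) := by
    rw [neg_sub, Real.rpow_sub hn0', Real.rpow_one]
  rw [h7]
  rw [← le_div_iff₀' (by positivity)] at h6
  refine h6.trans_eq ?_
  field_simp

lemma IsGeneralizedRandomGraph.measurable_ncard_edgeSet {Ω : Type*} [MeasurableSpace Ω]
    {P : Measure Ω} {n : ℕ} {W : Fin n → Ω → ℝ} {G : Ω → SimpleGraph (Fin n)}
    (hG : IsGeneralizedRandomGraph P W G) :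
    Measurable fun ω => ((G ω).edgeSet.ncard : ℝ) := by
  classical
  have h : (fun ω => ((G ω).edgeSet.ncard : ℝ))
      = fun ω => 2⁻¹ * ∑ i, ∑ j, if (G ω).Adj i j then (1 : ℝ) else 0 := by
    ext ω
    have h1 : 2 * ((G ω).edgeSet.ncard : ℝ) = ∑ i, ∑ j, if (G ω).Adj i j then (1 : ℝ) else 0 := by
      exact_mod_cast (G ω).two_mul_ncard_edgeSet
    rw [← h1]
    ring
  rw [h]
  refine (Finset.measurable_sum _ fun i _ => Finset.measurable_sum _ fun j _ => ?_).const_mul _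
  exact Measurable.ite (hG.measurableSet_adj i j) measurable_const measurable_const

/-! ### Choice of exponents and conclusion -/

lemma exists_exponents {α : ℝ} (hα : 1 < α) (hα' : α < 2) :
    ∃ s β γ : ℝ, 1 / 2 < s ∧ s < 1 / α ∧ 1 / α < γ ∧ 1 ≤ β ∧ β ≤ 2 ∧ β < 1 / γ ∧ 2 - β < s := by
  -- The bound 1/2 < 1/α is α < 2, and 2 - α < 1/α is (α - 1)² > 0. This leaves room for `s`, then
  -- for β in (max(1, 2 - s), α).
  have h1 : max (1 / 2) (2 - α) < 1 / α := by
    refine max_lt (one_div_lt_one_div_of_lt (by linarith) hα') ?_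
    rw [lt_div_iff₀ (by linarith)]
    nlinarith [sq_pos_of_pos (sub_pos.2 hα)]
  obtain ⟨s, hs, hsα⟩ := exists_between h1
  have hs1 := (le_max_left _ _).trans_lt hs
  have hs2 := (le_max_right _ _).trans_lt hs
  obtain ⟨β, hβ, hβα⟩ := exists_between (max_lt hα (by linarith : 2 - s < α))
  have hβ1 := (le_max_left _ _).trans_lt hβ
  have hβ2 := (le_max_right _ _).trans_lt hβ
  obtain ⟨γ', hγ, hγα⟩ := exists_between hβα
  refine ⟨s, β, 1 / γ', hs1, hsα, one_div_lt_one_div_of_lt (by linarith) hγα, hβ1.le, by linarith,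
    by rwa [one_div_one_div], by linarith⟩

/-- Consequences of attraction to a stable law: growth of the norming constants and moments. -/
lemma exists_growth_and_moments {Ω : Type*} [MeasurableSpace Ω] {P : Measure Ω}
    [IsProbabilityMeasure P] {W : ℕ → Ω → ℝ} (hW_meas : ∀ i, Measurable (W i))
    (hW_indep : iIndepFun W P) (hW_ident : ∀ i, IdentDistrib (W i) (W 0) P P)
    {d a : ℕ → ℝ} {α : ℝ} (hα : 0 < α) {F : Measure ℝ} [IsProbabilityMeasure F]
    (hF : IsStableLaw α F)
    (hlim : TendstoInDistribution
      (fun (n : ℕ) ω => ((∑ i ∈ Finset.range n, W i ω) - d n) / a n)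
      atTop (id : ℝ → ℝ) (fun _ => P) F) {s β γ : ℝ} (hs : s < 1 / α) (hγ : 1 / α < γ)
    (hβ : 1 ≤ β) (hβγ : β < 1 / γ) :
    (∃ K : ℝ, 0 < K ∧ ∀ᶠ n : ℕ in atTop, K * (n : ℝ) ^ s ≤ |a n|) ∧
    Integrable (fun ω => |W 0 ω| ^ β) P ∧ ¬ (W 0 =ᵐ[P] 0) := by
  have : IsProbabilityMeasure (P.map (W 0)) :=
    Measure.isProbabilityMeasure_map (hW_meas 0).aemeasurable
  obtain ⟨c, hc, hcF⟩ := hF.norm_charFun hα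
  set f : ℝ → ℝ := fun t => ‖charFun (P.map (W 0)) t‖ with hf
  have hf0 : f 0 = 1 := by simp [hf]
  obtain ⟨b, hb⟩ : ∃ b : ℕ → ℝ, ∀ n, b n = |a n| := ⟨_, fun _ => rfl⟩
  have hpow : ∀ t : ℝ, Tendsto (fun p : ℕ × ℝ => f (p.2 / b p.1) ^ p.1) (atTop ×ˢ 𝓝 t)
      (𝓝 (Real.exp (-(c * |t| ^ α)))) := by
    intro t
    rw [← hcF]
    refine (hlim.tendsto_charFun_prod t).norm.congr fun p => ?_
    rw [norm_charFun_map_sum hW_meas hW_indep hW_ident]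
    simp only [hf, hb]
    -- The modulus is even, so the signs of a_n do not matter.
    rw [← norm_charFun_abs, ← norm_charFun_abs _ (p.2 / |a p.1|), abs_div, abs_div, abs_abs]
  have hf_nonneg : ∀ t, 0 ≤ f t := fun t => norm_nonneg _
  have hf1 : ∀ t, f t ≤ 1 := fun t => norm_charFun_le_one (μ := P.map (W 0)) (t := t)
  have hb0 : ∀ n, 0 ≤ b n := fun n => hb n ▸ abs_nonneg _
  simp_rw [← hb]
  refine ⟨exists_mul_rpow_le_of_tendsto_pow hf0 hb0 hc hα hpow hs, ?_, ?_⟩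
  · obtain ⟨K, hK, hK'⟩ := exists_le_mul_rpow_of_tendsto_pow hf0 hb0 hc hα hpow hγ
    obtain ⟨C, hC, hC'⟩ := exists_one_sub_sq_le_of_tendsto_pow hf_nonneg hf1 hpow (isCompact_Icc (a := (-2 : ℝ)) (b := 2)) hα
    have h1 := integrable_abs_rpow_of_one_sub_sq_le (ν := P.map (W 0)) hK hC
      ((eventually_ne_zero_of_tendsto_pow hf0 hc hpow).mono fun n hn => (hb0 n).lt_of_ne' hn)
      hK' hC' ((one_div_pos.2 hα).trans hγ) hβ hβγ
    exact h1.comp_measurable (hW_meas 0)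
  -- If W vanished almost surely, the limit at t = 1 would be 1 rather than exp(-c).
  · intro h0
    have h1 : P.map (W 0) = Measure.dirac 0 := by
      rw [Measure.map_congr h0]
      simp [Pi.zero_def]
    have h2 : ∀ t, f t = 1 := fun t => by simp [hf, h1]
    have h3 := hpow 1
    simp only [h2, one_pow] at h3
    have h4 := tendsto_nhds_unique h3 tendsto_const_nhds
    simp at h4
    exact hc.ne' h4

/-- A stable limit for the total weight carries over to twice the number of edges. -/
theorem theorem2 {Ω : Type*} [MeasurableSpace Ω] (P : Measure Ω) [IsProbabilityMeasure P]
    (W : ℕ → Ω → ℝ)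
    (hW_meas : ∀ i, Measurable (W i))
    (hW_indep : iIndepFun W P)
    (hW_ident : ∀ i, IdentDistrib (W i) (W 0) P P)
    (hW_nonneg : ∀ i, ∀ᵐ ω ∂P, 0 ≤ W i ω)
    (hW_int : Integrable (W 0) P)
    (G : (n : ℕ) → Ω → SimpleGraph (Fin n))
    (hG : ∀ n : ℕ, IsGeneralizedRandomGraph P (fun i : Fin n => W i) (G n))
    (a : ℕ → ℝ) (α : ℝ) (hα : 1 < α) (hα' : α < 2)
    (F : Measure ℝ) [IsProbabilityMeasure F] (hF : IsStableLaw α F)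
    (hlim : TendstoInDistribution
      (fun (n : ℕ) ω => ((∑ i ∈ Finset.range n, W i ω) - n * ∫ ω', W 0 ω' ∂P) / a n)
      atTop (id : ℝ → ℝ) (fun _ => P) F) :
    TendstoInDistribution
      (fun (n : ℕ) ω => (2 * ((G n ω).edgeSet.ncard : ℝ) - n * ∫ ω', W 0 ω' ∂P) / a n)
      atTop (id : ℝ → ℝ) (fun _ => P) F := by
  obtain ⟨s, β, γ, hs, hsα, hγα, hβ1, hβ2, hβγ, hβs⟩ := exists_exponents hα hα'
  obtain ⟨⟨K, hK, hKa⟩, hWβ, hW0⟩ := exists_growth_and_moments hW_meas hW_indep hW_ident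
    (d := fun n => n * ∫ ω', W 0 ω' ∂P) (by linarith) hF hlim hsα hγα hβ1 hβγ
  have hmean : 0 < ∫ ω, W 0 ω ∂P := by
    refine (integral_nonneg_of_ae (hW_nonneg 0)).lt_of_ne' fun h => hW0 ?_
    exact (integral_eq_zero_iff_of_nonneg_ae (hW_nonneg 0) hW_int).1 h
  set Q : ℕ → Ω → ℝ := fun n ω =>
    ∑ i : Fin n, ∑ j : Fin n, if i = j then 0 else edgeProb (fun k : Fin n => W k ω) i j with hQ
  have hQ_meas : ∀ n, Measurable (Q n) := by
    intro n
    refine Finset.measurable_sum _ fun i _ => Finset.measurable_sum _ fun j _ => ?_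
    split_ifs
    · exact measurable_const
    · unfold edgeProb
      fun_prop
  have hE_meas : ∀ n, Measurable fun ω => ((G n ω).edgeSet.ncard : ℝ) := fun n =>
    (hG n).measurable_ncard_edgeSet
  have hWi_int : ∀ i, Integrable (W i) P := fun i => (hW_ident i).integrable_iff.2 hW_int
  have hvar : ∀ n, Integrable (fun ω => (2 * ((G n ω).edgeSet.ncard : ℝ) - Q n ω) ^ 2) P ∧
      ∫ ω, (2 * ((G n ω).edgeSet.ncard : ℝ) - Q n ω) ^ 2 ∂P ≤ (2 * ∫ ω, W 0 ω ∂P) * n := by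
    intro n
    obtain ⟨h1, h2⟩ := (hG n).integral_sq_le rfl (fun i => hW_meas i) (fun i => hW_nonneg i)
      (fun i => hWi_int i)
    refine ⟨h1, h2.trans_eq ?_⟩
    have h3 : ∀ i, ∫ ω, W i ω ∂P = ∫ ω, W 0 ω ∂P := fun i => (hW_ident i).integral_eq
    simp only [h3, Finset.sum_const, Finset.card_univ, Fintype.card_fin, nsmul_eq_mul]
    ring
  have hfluct : TendstoInMeasure P
      (fun n ω => (2 * ((G n ω).edgeSet.ncard : ℝ) - Q n ω) / a n) atTop (fun _ => 0) :=
    tendstoInMeasure_div_of_integral_sq_le hK hs hKa (fun n => (hvar n).1) (fun n => (hvar n).2)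
  have hmean_ae : ∀ᵐ ω ∂P, Tendsto
      (fun n => (Q n ω - ∑ i ∈ Finset.range n, W i ω) / a n) atTop (𝓝 0) := by
    have hSLLN := strong_law_ae_real W hW_int (fun i j hij => hW_indep.indepFun hij) hW_ident
    have hpow_meas : Measurable fun x : ℝ => |x| ^ β := by fun_prop
    have hSLLNβ := strong_law_ae_real (fun i ω => |W i ω| ^ β) hWβ
      (fun i j hij => (hW_indep.indepFun hij).comp hpow_meas hpow_meas)
      (fun i => (hW_ident i).comp hpow_meas)
    filter_upwards [ae_all_iff.2 hW_nonneg, hSLLN, hSLLNβ] with ω hω hL hV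
    have hL0 : ∀ n, 0 ≤ ∑ i ∈ Finset.range n, W i ω := fun n =>
      Finset.sum_nonneg fun i _ => hω i
    -- Here k = 2 treats the sum over all pairs, of order n^(2-β); below, k = 1 with β/2 treats the
    -- diagonal, of order n^(1-β/2).
    have h1 := tendsto_mul_rpow_neg_div_of_tendsto_div (a := fun n => |a n|) (β := β) 2 hL0 hmean
      hL hV hK (by simpa using hKa) (by simpa using hβs)
    have h2 := tendsto_mul_rpow_neg_div_of_tendsto_div (a := fun n => |a n|) (β := β / 2) 1 hL0
      hmean hL hV hK (by simpa using hKa) (by norm_num; linarith)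
    have h3 := h1.add h2
    rw [add_zero] at h3
    refine squeeze_zero_norm' ?_ h3
    have hLpos : ∀ᶠ n : ℕ in atTop, 0 < ∑ i ∈ Finset.range n, W i ω := by
      filter_upwards [hL.eventually_const_lt hmean] with n hn
      refine (hL0 n).lt_of_ne' fun h => ?_
      rw [h, zero_div] at hn
      exact lt_irrefl _ hn
    filter_upwards [hLpos] with n hn
    have hsum : ∀ g : ℕ → ℝ, ∑ k : Fin n, g k = ∑ k ∈ Finset.range n, g k := fun g =>
      Fin.sum_univ_eq_sum_range g n
    have h4 := abs_sum_edgeProb_offDiag_sub_le (w := fun k : Fin n => W k ω) (fun i => hω i)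
      (by rwa [hsum fun k => W k ω]) hβ1 hβ2
    rw [hsum fun k => W k ω, hsum fun k => W k ω ^ β] at h4
    rw [norm_div, Real.norm_eq_abs, Real.norm_eq_abs, ← add_div]
    simp only [abs_of_nonneg (hω _), pow_one]
    gcongr
  have hbias : TendstoInMeasure P
      (fun n ω => (Q n ω - ∑ i ∈ Finset.range n, W i ω) / a n) atTop (fun _ => 0) :=
    tendstoInMeasure_of_tendsto_ae (fun n => by
      have := hQ_meas n
      exact Measurable.aestronglyMeasurable (by fun_prop)) hmean_ae
  have hE_meas' : ∀ n, Measurable fun ω =>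
      (2 * ((G n ω).edgeSet.ncard : ℝ) - n * ∫ ω', W 0 ω' ∂P) / a n := fun n =>
    (((hE_meas n).const_mul 2).sub_const _).div_const _
  -- Slutsky is used twice: from L to Q by the bias estimate, then from Q to 2E by the fluctuation
  -- estimate.
  have hQlim : TendstoInDistribution (fun (n : ℕ) ω => (Q n ω - n * ∫ ω', W 0 ω' ∂P) / a n)
      atTop (id : ℝ → ℝ) (fun _ => P) F := by
    refine tendstoInDistribution_of_tendstoInMeasure_sub _ _ hlim ?_ fun n =>
      (((hQ_meas n).sub_const _).div_const _).aemeasurable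
    convert hbias using 1
    · ext n ω
      simp only [Pi.sub_apply]
      ring
    · rfl
  refine tendstoInDistribution_of_tendstoInMeasure_sub _ _ hQlim ?_ fun n =>
    (hE_meas' n).aemeasurable
  convert hfluct using 1
  · ext n ω
    simp only [Pi.sub_apply]
    ring
  · rfl
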